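/- Let $k$ be a field of characteristic zero, $R=k[t]$ and $B=R[x,y,z]$, graded by $\deg x=\deg y=\deg z=1$ and $\deg r=0$ for $r\in R\setminus\{0\}$. Put $$F=x(tz+x)-t^2y^2,\qquad G=(tz+x)F^2+2tx^2yF+x^5,\qquad P=tyF+x^3,$$ and let $D$ be the $R$-derivation of $B$ with $$Dx=-2t^2FP,\qquad Dy=t(6x^2P-G),\qquad Dz=2x(5t^2yP+tF^2)+2tFP.$$ Put also $F_1=xz-ty^2$, $$G_1=x^4z+2tx^2F_1z+t^2F_1^2z+2x^3F_1+txF_1^2+2x^2yF,$$ $$H=4x^5G_1+tG_1^2-20x^8F_1-40tx^6F_1^2-40t^2x^4F_1^3-20t^3x^2F_1^4-4t^4F_1^5.$$ Then: 1. $F$, $G$, $P$ are homogeneous of degrees $2$, $5$, $3$. The derivation $D$ is nonzero, locally nilpotent and homogeneous of degree $4$ (so of degree $>3$), that is, it maps homogeneous polynomials of degree $i$ to homogeneous polynomials of degree $i+4$. Moreover $D^3(x)=D^7(y)=D^{11}(z)=0$. 2. $G^2-4F^5=tH$, and $\ker D=k[t,F,G,H]$. The assignment $t\mapsto t$, $L\mapsto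 F$, $M\mapsto G$, $N\mapsto H$ induces an isomorphism of $k$-algebras $$k[t,L,M,N]/(tN-M^2+4L^5)\;\cong\;\ker D .$$ 3. $\ker D\neq R^{[2]}$, that is, $\ker D$ is not isomorphic as an $R$-algebra to a polynomial ring in two variables over $R$. 4. $\ker D$ contains no nonzero linear form in $x,y,z$ with coefficients in $R$, and $\operatorname{rank}(D)=3$. Here $\operatorname{rank}(D)$ is the least $r$ for which there are $X_1,X_2,X_3\in B$ with $B=R[X_1,X_2,X_3]$ such that exactly $r$ of $DX_1,DX_2,DX_3$ are nonzero. -/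

import Mathlib

noncomputable section

namespace HomLND

/-- A derivation `D` of the `R`-algebra `A` is locally nilpotent if every element of `A` is killed
by some iterate of `D`. -/
def IsLocallyNilpotent {R A : Type*} [CommRing R] [CommRing A] [Algebra R A]
    (D : Derivation R A A) : Prop :=
  ∀ a : A, ∃ n : ℕ, D^[n] a = 0

/-- The kernel of an `R`-derivation `D` of `A`, as an `R`-subalgebra of `A`. -/
def kernel {R A : Type*} [CommRing R] [CommRing A] [Algebra R A]
    (D : Derivation R A A) : Subalgebra R A where
  carrier := {a | D a = 0}
  mul_mem' := by
    intro a b ha hb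
    simp only [Set.mem_ofPred_eq] at ha hb ⊢
    rw [D.leibniz, ha, hb, smul_zero, smul_zero, add_zero]
  add_mem' := by
    intro a b ha hb
    simp only [Set.mem_ofPred_eq] at ha hb ⊢
    rw [D.map_add, ha, hb, add_zero]
  algebraMap_mem' := fun r => D.map_algebraMap r

/-- A derivation `D` of `R[X_i : i ∈ σ]` is homogeneous of degree `d` for the standard grading
(all variables of weight one, `R` in degree zero) if it is nonzero and maps homogeneous polynomials
of degree `i` to homogeneous polynomials of degree `i + d`. -/
def IsHomogeneousOfDegree {R σ : Type*} [CommRing R]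
    (D : Derivation R (MvPolynomial σ R) (MvPolynomial σ R)) (d : ℕ) : Prop :=
  D ≠ 0 ∧ ∀ (i : ℕ) (b : MvPolynomial σ R), b.IsHomogeneous i → (D b).IsHomogeneous (i + d)

/-- The rank of an `R`-derivation `D` of the polynomial ring `R[X_i : i ∈ σ]`: the least `r` such
that for some system of variables of this ring (the image of the family of the `X_i` under
an `R`-algebra automorphism) exactly `r` of its members are not in the kernel of `D`. -/
def rank {R σ : Type*} [CommRing R] [Fintype σ]
    (D : Derivation R (MvPolynomial σ R) (MvPolynomial σ R)) : ℕ :=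
  sInf {r : ℕ | ∃ φ : MvPolynomial σ R ≃ₐ[R] MvPolynomial σ R,
    Set.ncard {i : σ | D (φ (MvPolynomial.X i)) ≠ 0} = r}

/-- `A = R^{[n]}`: the `R`-algebra `A` is isomorphic to a polynomial ring in `n` variables
over `R`. -/
def IsPolynomialRing (R A : Type*) [CommRing R] [CommRing A] [Algebra R A] (n : ℕ) : Prop :=
  Nonempty (A ≃ₐ[R] MvPolynomial (Fin n) R)

section Example

variable (k : Type*) [Field k]

/-- The polynomial ring `B = R[x, y, z]` over `R = k[t]`. -/
abbrev B : Type _ := MvPolynomial (Fin 3) (Polynomial k)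

/-- The element `t` of `R = k[t]`, seen in `B`. -/
def t : B k := MvPolynomial.C Polynomial.X

/-- The variable `x` of `B`. -/
def x : B k := MvPolynomial.X 0

/-- The variable `y` of `B`. -/
def y : B k := MvPolynomial.X 1

/-- The variable `z` of `B`. -/
def z : B k := MvPolynomial.X 2

/-- `F = x (t z + x) - t² y²`. -/
def F : B k := x k * (t k * z k + x k) - t k ^ 2 * y k ^ 2

/-- `G = (t z + x) F² + 2 t x² y F + x⁵`. -/
def G : B k :=
  (t k * z k + x k) * F k ^ 2 + 2 * t k * x k ^ 2 * y k * F k + x k ^ 5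

/-- `P = t y F + x³`. -/
def P : B k := t k * y k * F k + x k ^ 3

/-- `F₁ = x z - t y²`. -/
def F₁ : B k := x k * z k - t k * y k ^ 2

/-- `G₁ = x⁴ z + 2 t x² F₁ z + t² F₁² z + 2 x³ F₁ + t x F₁² + 2 x² y F`. -/
def G₁ : B k :=
  x k ^ 4 * z k + 2 * t k * x k ^ 2 * F₁ k * z k + t k ^ 2 * F₁ k ^ 2 * z k
    + 2 * x k ^ 3 * F₁ k + t k * x k * F₁ k ^ 2 + 2 * x k ^ 2 * y k * F k

/-- `H = 4 x⁵ G₁ + t G₁² - 20 x⁸ F₁ - 40 t x⁶ F₁² - 40 t² x⁴ F₁³ - 20 t³ x² F₁⁴ - 4 t⁴ F₁⁵`. -/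
def H : B k :=
  4 * x k ^ 5 * G₁ k + t k * G₁ k ^ 2 - 20 * x k ^ 8 * F₁ k - 40 * t k * x k ^ 6 * F₁ k ^ 2
    - 40 * t k ^ 2 * x k ^ 4 * F₁ k ^ 3 - 20 * t k ^ 3 * x k ^ 2 * F₁ k ^ 4
    - 4 * t k ^ 4 * F₁ k ^ 5

/-- The `R`-derivation `D` of `B` with `D x = -2 t² F P`, `D y = t (6 x² P - G)` and
`D z = 2 x (5 t² y P + t F²) + 2 t F P`. -/
def D : Derivation (Polynomial k) (B k) (B k) :=
  MvPolynomial.mkDerivation (Polynomial k)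
    ![-2 * t k ^ 2 * F k * P k,
      t k * (6 * x k ^ 2 * P k - G k),
      2 * x k * (5 * t k ^ 2 * y k * P k + t k * F k ^ 2) + 2 * t k * F k * P k]

/-- The polynomial `t N - M² + 4 L⁵` of `k[t, L, M, N]`; here `t, L, M, N` are the variables
with the indices `0, 1, 2, 3`. -/
def relation : MvPolynomial (Fin 4) k :=
  MvPolynomial.X 0 * MvPolynomial.X 3 - MvPolynomial.X 2 ^ 2 + 4 * MvPolynomial.X 1 ^ 5

end Example

end HomLND

end

noncomputable section

namespace HomLND

/-! ### Identities between `F`, `G`, `P` and their images under `D`. -/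

section Generators

variable (k : Type*) [Field k]

/-! The derivation kills `t`, `F`, `G` and sends `P` to `-t²FG`, so `P` is a local slice. The
identities `xG = F³ + P²`, `tFy = P - x³` and the definition of `G`, which is linear in `tF²z`
modulo `F`, `x`, `y`, express `x`, `y`, `z` through `P` over `R[F, G]` once `tFG` is inverted.
Nilpotency degrees then follow in the order `P`, `x`, `y`, `z`, since multiplying by a nonzero
kernel element does not change them.

For the kernel, clear denominators: `(tFG)ⁿ b` lies in `R[F, G][P]`, and a polynomial in a local
slice that `D` kills is constant, so it lies in `R[F, G]`. Powers of `F` and `G` can be cancelled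
inside `R[F, G]`, but `t` cannot, because `G² - 4F⁵` is divisible by `t`. Adjoining the quotient `H`
repairs this: modulo `t` and `z` the elements `F`, `G`, `H` become `x²`, `2x⁵`, `8x⁹y`, whose only
relation is the reduction of `tN - M² + 4L⁵`. So `t` can be cancelled in `k[t, F, G, H]`. The
presentation follows by eliminating `N` after inverting `t`, as `F` and `G` are algebraically
independent and the prime `t` does not divide the relation.

If the kernel were `R[u, v]`, then modulo `t` the equation `M² = 4L⁵` would hold in the integrally
closed ring `k[u, v]` and make `L` a square. On the line `t = y = z = 0` this gives a kernel element
restricting to `±x`, whereas the kernel restricts into `k[x², x⁵]`.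

For the rank, the kernel is graded and has no linear forms, while every variable of `B` has a
nonzero linear part. So no variable lies in the kernel. -/

lemma D_t : D k (t k) = 0 := (D k).map_algebraMap _

lemma D_x : D k (x k) = -2 * t k ^ 2 * F k * P k := by
  simp [D, x]

lemma D_y : D k (y k) = t k * (6 * x k ^ 2 * P k - G k) := by
  simp [D, y]

lemma D_z : D k (z k) =
    2 * x k * (5 * t k ^ 2 * y k * P k + t k * F k ^ 2) + 2 * t k * F k * P k := by
  simp [D, z]

lemma D_two : D k 2 = 0 := (D k).map_natCast 2

lemma D_F : D k (F k) = 0 := by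
  have h : D k (F k) = D k (x k * (t k * z k + x k) - t k ^ 2 * y k ^ 2) := rfl
  rw [h]
  simp only [map_sub, map_add, Derivation.leibniz, Derivation.leibniz_pow, smul_eq_mul, D_t, D_x,
    D_y, D_z, nsmul_eq_mul]
  simp only [P, G, F]
  push_cast
  ring

lemma D_G : D k (G k) = 0 := by
  have h : D k (G k) = D k ((t k * z k + x k) * F k ^ 2 + 2 * t k * x k ^ 2 * y k * F k
    + x k ^ 5) := rfl
  rw [h]
  simp only [map_add, Derivation.leibniz, Derivation.leibniz_pow, smul_eq_mul, D_t, D_x,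
    D_y, D_z, D_F, D_two, nsmul_eq_mul]
  simp only [P, G, F]
  push_cast
  ring

lemma D_P : D k (P k) = - t k ^ 2 * F k * G k := by
  have h : D k (P k) = D k (t k * y k * F k + x k ^ 3) := rfl
  rw [h]
  simp only [map_add, Derivation.leibniz, Derivation.leibniz_pow, smul_eq_mul, D_t, D_x,
    D_y, D_F, nsmul_eq_mul]
  push_cast
  ring

lemma x_mul_G : x k * G k = F k ^ 3 + P k ^ 2 := by
  simp only [P, G, F]
  ring

lemma G_sq_sub : G k ^ 2 - 4 * F k ^ 5 = t k * H k := by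
  simp only [H, G₁, F₁, G, F]
  ring

end Generators

/-! ### Nilpotency degrees and local slices for general derivations. -/

section Derivations

variable {R A : Type*} [CommRing R] [CommRing A] [Algebra R A] (D : Derivation R A A)

lemma iterate_eq_zero_of_le {f : A} {m n : ℕ} (hmn : m ≤ n) (hf : D^[m] f = 0) :
    D^[n] f = 0 := by
  obtain ⟨d, rfl⟩ := Nat.exists_eq_add_of_le hmn
  rw [Nat.add_comm, Function.iterate_add_apply, hf, iterate_map_zero]

/-- The nilpotency degrees of a derivation are subadditive on products. -/
lemma iterate_mul_eq_zero {a b : ℕ} {f g : A} (hf : D^[a + 1] f = 0) (hg : D^[b + 1] g = 0) :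
    D^[a + b + 1] (f * g) = 0 := by
  induction h : a + b generalizing a b f g with
  | zero =>
    obtain ⟨rfl, rfl⟩ : a = 0 ∧ b = 0 := by omega
    simp only [zero_add, Function.iterate_one] at hf hg ⊢
    simp [hf, hg]
  | succ n ih =>
    rw [Function.iterate_succ_apply, D.leibniz, iterate_map_add, smul_eq_mul, smul_eq_mul]
    rw [Function.iterate_succ_apply] at hf hg
    have h₁ : D^[n + 1] (f * D g) = 0 := by
      cases b with
      | zero => rw [Function.iterate_zero_apply] at hg; rw [hg, mul_zero, iterate_map_zero]
      | succ b => exact ih (a := a) (b := b) (by rwa [Function.iterate_succ_apply]) hg (by omega)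
    have h₂ : D^[n + 1] (g * D f) = 0 := by
      cases a with
      | zero => rw [Function.iterate_zero_apply] at hf; rw [hf, mul_zero, iterate_map_zero]
      | succ a => exact ih (a := b) (b := a) (by rwa [Function.iterate_succ_apply]) hf (by omega)
    rw [h₁, h₂, add_zero]

lemma iterate_mul_of_mem_kernel {c : A} (hc : D c = 0) (f : A) (n : ℕ) :
    D^[n] (c * f) = c * D^[n] f := by
  induction n generalizing f with
  | zero => rfl
  | succ n ih =>
    rw [Function.iterate_succ_apply, Function.iterate_succ_apply, D.leibniz, hc, smul_zero,
      add_zero, smul_eq_mul, ih]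

/-- A derivation of a polynomial ring is locally nilpotent as soon as it is so on the variables. -/
lemma isLocallyNilpotent_of_X {σ : Type*}
    (D : Derivation R (MvPolynomial σ R) (MvPolynomial σ R))
    (h : ∀ i, ∃ n : ℕ, D^[n] (MvPolynomial.X i) = 0) : IsLocallyNilpotent D := by
  intro p
  induction p using MvPolynomial.induction_on with
  | C r => exact ⟨1, D.map_algebraMap r⟩
  | add p q hp hq =>
    obtain ⟨m, hm⟩ := hp
    obtain ⟨n, hn⟩ := hq
    refine ⟨max m n, ?_⟩
    rw [iterate_map_add, iterate_eq_zero_of_le D (le_max_left m n) hm,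
      iterate_eq_zero_of_le D (le_max_right m n) hn, add_zero]
  | mul_X p i hp =>
    obtain ⟨m, hm⟩ := hp
    obtain ⟨n, hn⟩ := h i
    exact ⟨m + n + 1, iterate_mul_eq_zero D (iterate_eq_zero_of_le D (Nat.le_succ m) hm)
      (iterate_eq_zero_of_le D (Nat.le_succ n) hn)⟩

/-- A derivation that kills the coefficients of a polynomial satisfies the chain rule. -/
lemma derivation_aeval {S : Subalgebra R A} (hS : S ≤ kernel D) (q : Polynomial S) (a : A) :
    D (Polynomial.aeval a q) = Polynomial.aeval a (Polynomial.derivative q) * D a := by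
  induction q using Polynomial.induction_on' with
  | add p q hp hq => rw [map_add, map_add, hp, hq, Polynomial.derivative_add, map_add, add_mul]
  | monomial n s =>
    have hs : D (s : A) = 0 := hS s.2
    rw [Polynomial.derivative_monomial, Polynomial.aeval_monomial, Polynomial.aeval_monomial]
    simp only [Derivation.leibniz, Derivation.leibniz_pow, Subalgebra.algebraMap_def,
      Algebra.algebraMap_self_apply, hs, smul_eq_mul, nsmul_eq_mul, mul_zero, add_zero]
    push_cast
    ring

/-- A local slice of a derivation is transcendental over its kernel. -/
lemma eq_zero_of_aeval_eq_zero [IsDomain A] [CharZero A] {S : Subalgebra R A} (hS : S ≤ kernel D)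
    {a : A} (ha : D a ≠ 0) (q : Polynomial S) (hq : Polynomial.aeval a q = 0) : q = 0 := by
  induction h : q.natDegree using Nat.strong_induction_on generalizing q with
  | _ n ih =>
    have hd : Polynomial.aeval a (Polynomial.derivative q) = 0 := by
      have := derivation_aeval D hS q a
      rw [hq, map_zero] at this
      exact (mul_eq_zero.mp this.symm).resolve_right ha
    have hq' : Polynomial.derivative q = 0 := by
      by_cases hn : q.natDegree = 0
      · exact Polynomial.derivative_of_natDegree_zero hn
      · exact ih _ (h ▸ Polynomial.natDegree_derivative_lt hn) _ hd rfl
    have hc := Polynomial.eq_C_of_derivative_eq_zero hq'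
    rw [hc, Polynomial.aeval_C] at hq
    have h0 : q.coeff 0 = 0 := Subtype.val_injective hq
    rw [hc, h0, map_zero]

/-- By the chain rule `q'(a) · D a = 0`. Transcendence of `a` forces `q' = 0`, and in characteristic
zero `q` is then constant. -/
lemma aeval_mem_of_mem_kernel [IsDomain A] [CharZero A] {S : Subalgebra R A} (hS : S ≤ kernel D)
    {a : A} (ha : D a ≠ 0) (q : Polynomial S) (hq : D (Polynomial.aeval a q) = 0) :
    Polynomial.aeval a q ∈ S := by
  rw [derivation_aeval D hS] at hq
  have hq' := eq_zero_of_aeval_eq_zero D hS ha _ ((mul_eq_zero.mp hq).resolve_right ha)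
  rw [Polynomial.eq_C_of_derivative_eq_zero hq', Polynomial.aeval_C]
  exact (q.coeff 0).2

end Derivations

/-! ### Local nilpotency of `D`. -/

section Nilpotency

variable (k : Type*) [Field k]

lemma t_ne_zero : t k ≠ 0 := by
  simp [t]

lemma F_ne_zero : F k ≠ 0 := fun h => by
  have := congrArg (MvPolynomial.eval ![1, 0, 0]) h
  simp [F, x, y, z, t] at this

lemma G_ne_zero [CharZero k] : G k ≠ 0 := fun h => by
  have := congrArg (MvPolynomial.eval ![1, 0, 0]) h
  simp [G, F, x, y, z, t] at this

lemma t_mul_F_mul_y : t k * F k * y k = P k - x k ^ 3 := by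
  simp only [P]; ring

lemma t_mul_F_sq_mul_z : t k * F k ^ 2 * z k =
    G k - 2 * (t k * F k) * (x k * x k * y k) - x k ^ 5 - F k ^ 2 * x k := by
  simp only [G]; ring

lemma iterate_D_x [CharZero k] : (D k)^[3] (x k) = 0 := by
  have hP : (D k)^[1 + 1] (P k) = 0 := by
    simp [D_P, Derivation.leibniz, Derivation.leibniz_pow, D_t, D_F, D_G]
  -- `D²P = 0` gives `D³(P²) = 0`, so `xG = F³ + P²` is killed by `D³`, and the kernel element `G`
  -- can be cancelled.
  have h := iterate_mul_of_mem_kernel (D k) (D_G k) (x k) 3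
  rw [mul_comm, x_mul_G, iterate_map_add, pow_two (P k),
    iterate_mul_eq_zero (D k) hP hP, add_zero,
    iterate_eq_zero_of_le (D k) (m := 1) (by norm_num)
      (by simp [Derivation.leibniz_pow, D_F])] at h
  exact (mul_eq_zero.mp h.symm).resolve_left (G_ne_zero k)

lemma iterate_D_x_mul_x [CharZero k] : (D k)^[5] (x k * x k) = 0 :=
  iterate_mul_eq_zero (D k) (a := 2) (b := 2) (iterate_D_x k) (iterate_D_x k)

lemma iterate_D_x_cube [CharZero k] : (D k)^[7] (x k ^ 3) = 0 := by
  rw [pow_succ, pow_two]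
  exact iterate_mul_eq_zero (D k) (a := 4) (b := 2) (iterate_D_x_mul_x k) (iterate_D_x k)

/-- In `tFy = P - x³` the term `x³` dominates: since `D³x = 0`, it is killed by the iterate of order
`3 · 2 + 1`. -/
lemma iterate_D_y [CharZero k] : (D k)^[7] (y k) = 0 := by
  have hc : D k (t k * F k) = 0 := by simp [Derivation.leibniz, D_t, D_F]
  have h := iterate_mul_of_mem_kernel (D k) hc (y k) 7
  rw [t_mul_F_mul_y, iterate_map_sub, iterate_D_x_cube, sub_zero,
    iterate_eq_zero_of_le (D k) (m := 2) (by norm_num)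
      (by simp [D_P, Derivation.leibniz, Derivation.leibniz_pow, D_t, D_F, D_G])] at h
  exact (mul_eq_zero.mp h.symm).resolve_left (mul_ne_zero (t_ne_zero k) (F_ne_zero k))

/-- In the formula for `tF²z` the terms `x²y` and `x⁵` carry the largest bounds, `4 + 6` and `5 ·
2`, both giving order `11`. -/
lemma iterate_D_z [CharZero k] : (D k)^[11] (z k) = 0 := by
  have hc : D k (t k * F k ^ 2) = 0 := by
    simp [Derivation.leibniz, Derivation.leibniz_pow, D_t, D_F]
  have hc₁ : D k (2 * (t k * F k)) = 0 := by simp [Derivation.leibniz, D_t, D_F, D_two]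
  have hc₂ : D k (F k ^ 2) = 0 := by simp [Derivation.leibniz_pow, D_F]
  have h₅ : (D k)^[11] (x k ^ 5) = 0 := by
    have : x k ^ 5 = x k ^ 3 * (x k * x k) := by ring
    rw [this]
    exact iterate_mul_eq_zero (D k) (a := 6) (b := 4) (iterate_D_x_cube k) (iterate_D_x_mul_x k)
  have hy : (D k)^[11] (x k * x k * y k) = 0 :=
    iterate_mul_eq_zero (D k) (a := 4) (b := 6) (iterate_D_x_mul_x k) (iterate_D_y k)
  have h := iterate_mul_of_mem_kernel (D k) hc (z k) 11
  rw [t_mul_F_sq_mul_z, iterate_map_sub, iterate_map_sub, iterate_map_sub,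
    iterate_mul_of_mem_kernel (D k) hc₁, iterate_mul_of_mem_kernel (D k) hc₂, hy, h₅,
    iterate_eq_zero_of_le (D k) (m := 3) (by norm_num) (iterate_D_x k),
    iterate_eq_zero_of_le (D k) (m := 1) (by norm_num) (D_G k)] at h
  simp only [mul_zero, sub_zero] at h
  exact (mul_eq_zero.mp h.symm).resolve_left
    (mul_ne_zero (t_ne_zero k) (pow_ne_zero 2 (F_ne_zero k)))

lemma isLocallyNilpotent_D [CharZero k] : IsLocallyNilpotent (D k) := by
  refine isLocallyNilpotent_of_X (D k) fun i => ?_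
  fin_cases i
  exacts [⟨3, iterate_D_x k⟩, ⟨7, iterate_D_y k⟩, ⟨11, iterate_D_z k⟩]

end Nilpotency

/-! ### Grading, linear forms in the kernel, and rank. -/

section Homogeneous

open MvPolynomial in
lemma derivation_eq_sum_pderiv {R σ : Type*} [CommRing R] [Fintype σ]
    (D : Derivation R (MvPolynomial σ R) (MvPolynomial σ R)) (p : MvPolynomial σ R) :
    D p = ∑ i, pderiv i p * D (X i) := by
  classical
  have hs (q : MvPolynomial σ R) :
      (∑ i, D (X i) • pderiv i) q = ∑ i, pderiv i q * D (X i) := by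
    have := congrFun (map_sum (Derivation.coeFnAddMonoidHom (R := R) (A := MvPolynomial σ R)
      (M := MvPolynomial σ R)) (fun i => D (X i) • pderiv i) Finset.univ) q
    refine this.trans ((Finset.sum_apply _ _ _).trans (Finset.sum_congr rfl fun i _ => ?_))
    exact mul_comm _ _
  have h : D = ∑ i, D (X i) • pderiv i :=
    MvPolynomial.derivation_ext fun j => by simp [hs, pderiv_X, Pi.single_apply]
  conv_lhs => rw [h]
  exact hs p

open MvPolynomial in
/-- A derivation is homogeneous of degree `d` if it maps the variables to forms of degree
`d + 1`. -/
lemma isHomogeneous_derivation {R σ : Type*} [CommRing R] [Fintype σ]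
    {D : Derivation R (MvPolynomial σ R) (MvPolynomial σ R)} {d : ℕ}
    (hD : ∀ i, (D (X i)).IsHomogeneous (d + 1)) {n : ℕ} {p : MvPolynomial σ R}
    (hp : p.IsHomogeneous n) : (D p).IsHomogeneous (n + d) := by
  cases n with
  | zero =>
    rw [← homogeneousComponent_eq_self hp, homogeneousComponent_zero, derivation_C]
    exact isHomogeneous_zero _ _ _
  | succ n =>
    rw [derivation_eq_sum_pderiv]
    refine IsHomogeneous.sum _ _ _ fun i _ => ?_
    have h := (hp.pderiv (i := i)).mul (hD i)
    rwa [show n + 1 - 1 + (d + 1) = n + 1 + d by omega] at h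

open MvPolynomial in
/-- The kernel of a homogeneous derivation is a graded subring. -/
lemma derivation_homogeneousComponent_eq_zero {R σ : Type*} [CommRing R]
    {D : Derivation R (MvPolynomial σ R) (MvPolynomial σ R)} {d : ℕ}
    (hD : ∀ (n : ℕ) (p : MvPolynomial σ R), p.IsHomogeneous n → (D p).IsHomogeneous (n + d))
    {p : MvPolynomial σ R} (hp : D p = 0) (n : ℕ) : D (homogeneousComponent n p) = 0 := by
  have h : homogeneousComponent (n + d) (D p) =
      ∑ i ∈ Finset.range (p.totalDegree + 1), if n = i then D (homogeneousComponent i p) else 0 := by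
    conv_lhs => rw [← sum_homogeneousComponent p, map_sum, map_sum]
    refine Finset.sum_congr rfl fun i _ => ?_
    rw [homogeneousComponent_of_mem (hD i _ (homogeneousComponent_isHomogeneous i p))]
    simp
  rw [hp, map_zero, Finset.sum_ite_eq] at h
  split_ifs at h with hn
  · exact h.symm
  · rw [homogeneousComponent_eq_zero, map_zero]
    simpa [Nat.lt_succ_iff] using hn

open MvPolynomial in
/-- A member of a system of variables of a polynomial ring has a nonzero linear part. -/
lemma homogeneousComponent_one_automorphism_ne_zero {R σ : Type*} [CommRing R] [Nontrivial R]
    [Fintype σ] (φ : MvPolynomial σ R ≃ₐ[R] MvPolynomial σ R) (i : σ) :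
    homogeneousComponent 1 (φ (X i)) ≠ 0 := by
  intro h
  -- The conjugate of `∂ᵢ` by `φ` sends `φ(Xᵢ)` to `1`. Without a linear part, all partial
  -- derivatives of `φ(Xᵢ)` would have zero constant term, and so would its image under any
  -- derivation.
  let δ : Derivation R (MvPolynomial σ R) (MvPolynomial σ R) :=
    Derivation.mk' (φ.toLinearMap ∘ₗ (pderiv i).toLinearMap ∘ₗ φ.symm.toLinearMap)
      (fun a b => by simp [Derivation.leibniz])
  have hδ : δ (φ (X i)) = 1 := by
    change φ (pderiv i (φ.symm (φ (X i)))) = 1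
    simp
  have h₁ := congrArg (coeff 0) (derivation_eq_sum_pderiv δ (φ (X i)))
  rw [hδ, ← constantCoeff_eq, map_one, map_sum] at h₁
  refine one_ne_zero (h₁.trans (Finset.sum_eq_zero fun j _ => ?_))
  have hj : coeff (Finsupp.single j 1) (φ (X i)) = 0 := by
    have := congrArg (coeff (Finsupp.single j 1)) h
    rwa [coeff_homogeneousComponent, if_pos (by simp), coeff_zero] at this
  rw [map_mul, constantCoeff_eq, coeff_pderiv, zero_add, hj, zero_mul, zero_mul]

variable (k : Type*) [Field k]

lemma isHomogeneous_t : (t k).IsHomogeneous 0 := MvPolynomial.isHomogeneous_C _ _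
lemma isHomogeneous_x : (x k).IsHomogeneous 1 := MvPolynomial.isHomogeneous_X _ _
lemma isHomogeneous_y : (y k).IsHomogeneous 1 := MvPolynomial.isHomogeneous_X _ _
lemma isHomogeneous_z : (z k).IsHomogeneous 1 := MvPolynomial.isHomogeneous_X _ _

lemma isHomogeneous_natCast (n : ℕ) : (n : B k).IsHomogeneous 0 := by
  rw [← map_natCast (MvPolynomial.C (σ := Fin 3) (R := Polynomial k))]
  exact MvPolynomial.isHomogeneous_C _ _

lemma isHomogeneous_tz_add_x : (t k * z k + x k).IsHomogeneous 1 :=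
  ((isHomogeneous_t k).mul (isHomogeneous_z k)).add (isHomogeneous_x k)

lemma isHomogeneous_F : (F k).IsHomogeneous 2 :=
  ((isHomogeneous_x k).mul (isHomogeneous_tz_add_x k)).sub
    (((isHomogeneous_t k).pow 2).mul ((isHomogeneous_y k).pow 2))

lemma isHomogeneous_G : (G k).IsHomogeneous 5 :=
  (((isHomogeneous_tz_add_x k).mul ((isHomogeneous_F k).pow 2)).add
    (((((isHomogeneous_natCast k 2).mul (isHomogeneous_t k)).mul ((isHomogeneous_x k).pow 2)).mul
      (isHomogeneous_y k)).mul (isHomogeneous_F k))).add ((isHomogeneous_x k).pow 5)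

lemma isHomogeneous_P : (P k).IsHomogeneous 3 :=
  (((isHomogeneous_t k).mul (isHomogeneous_y k)).mul (isHomogeneous_F k)).add
    ((isHomogeneous_x k).pow 3)

lemma isHomogeneous_D_X (i : Fin 3) : (D k (MvPolynomial.X i)).IsHomogeneous (4 + 1) := by
  have ht := isHomogeneous_t k
  have hx := isHomogeneous_x k
  have hF := isHomogeneous_F k
  have hP := isHomogeneous_P k
  have hn := isHomogeneous_natCast k
  fin_cases i
  · have h := (D_x k).trans (by push_cast; ring :
      _ = -(((2 : ℕ) : B k) * t k ^ 2 * F k * P k))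
    exact h ▸ ((((hn 2).mul (ht.pow 2)).mul hF).mul hP).neg
  · have h := (D_y k).trans (by push_cast; ring :
      _ = t k * (((6 : ℕ) : B k) * x k ^ 2 * P k - G k))
    exact h ▸ ht.mul ((((hn 6).mul (hx.pow 2)).mul hP).sub (isHomogeneous_G k))
  · have h := (D_z k).trans (by push_cast; ring :
      _ = ((2 : ℕ) : B k) * x k * (((5 : ℕ) : B k) * t k ^ 2 * y k * P k + t k * F k ^ 2)
        + ((2 : ℕ) : B k) * t k * F k * P k)
    refine h ▸ (((hn 2).mul hx).mul (((((hn 5).mul (ht.pow 2)).mul (isHomogeneous_y k)).mul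
      hP).add (ht.mul (hF.pow 2)))).add ((((hn 2).mul ht).mul hF).mul hP)

lemma D_ne_zero : D k ≠ 0 := fun h => by
  have := congrArg (MvPolynomial.eval ![0, 1, 1]) (D_y k)
  simp [h, G, P, F, x, y, z, t] at this

lemma isHomogeneousOfDegree_D : IsHomogeneousOfDegree (D k) 4 :=
  ⟨D_ne_zero k, fun _ _ hb => isHomogeneous_derivation (isHomogeneous_D_X k) hb⟩

/-- Euler's identity, with partial derivatives of degree zero and hence constant. -/
lemma eq_sum_of_isHomogeneous_one {R : Type*} [CommRing R] {b : MvPolynomial (Fin 3) R}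
    (hb : b.IsHomogeneous 1) :
    ∃ α β γ : R, b = MvPolynomial.C α * MvPolynomial.X 0 + MvPolynomial.C β * MvPolynomial.X 1
      + MvPolynomial.C γ * MvPolynomial.X 2 := by
  have h (i : Fin 3) : ∃ r, MvPolynomial.pderiv i b = MvPolynomial.C r := by
    have := MvPolynomial.homogeneousComponent_eq_self (hb.pderiv (i := i))
    rw [Nat.sub_self, MvPolynomial.homogeneousComponent_zero] at this
    exact ⟨_, this.symm⟩
  choose r hr using h
  refine ⟨r 0, r 1, r 2, ?_⟩
  have := hb.sum_X_mul_pderiv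
  rw [one_smul, Fin.sum_univ_three, hr, hr, hr] at this
  rw [← this]
  ring

lemma eq_zero_of_mem_kernel_of_isHomogeneous_one [CharZero k] {b : B k} (hD : D k b = 0)
    (hb : b.IsHomogeneous 1) : b = 0 := by
  obtain ⟨α, β, γ, rfl⟩ := eq_sum_of_isHomogeneous_one hb
  have h : MvPolynomial.C α * D k (x k) + MvPolynomial.C β * D k (y k)
      + MvPolynomial.C γ * D k (z k) = 0 := by
    simpa [Derivation.leibniz, x, y, z] using hD
  rw [D_x, D_y, D_z] at h
  -- At these three points `(Dx, Dy, Dz)` equals `(-2t⁷, 0, 2t⁶)`, `(-2t⁷, -t⁶, 2t⁶)` and `(-2t²,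
  -- 4t, 4t)`, a nonsingular system for `α, β, γ`.
  have h₁ := congrArg (MvPolynomial.eval ![0, 1, 0]) h
  have h₂ := congrArg (MvPolynomial.eval ![0, 1, 1]) h
  have h₃ := congrArg (MvPolynomial.eval ![1, 0, 0]) h
  simp [G, P, F, x, y, z, t] at h₁ h₂ h₃
  have hX : (Polynomial.X : Polynomial k) ≠ 0 := Polynomial.X_ne_zero
  have hβ : β = 0 := by
    have : Polynomial.X ^ 6 * β = 0 := by linear_combination h₁ - h₂
    exact (mul_eq_zero.mp this).resolve_left (pow_ne_zero _ hX)
  have hγ : γ = Polynomial.X * α := by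
    have : 2 * Polynomial.X ^ 6 * (γ - Polynomial.X * α) = 0 := by linear_combination h₁
    exact sub_eq_zero.mp
      ((mul_eq_zero.mp this).resolve_left (mul_ne_zero two_ne_zero (pow_ne_zero _ hX)))
  have hα : α = 0 := by
    rw [hβ, hγ] at h₃
    have : 2 * Polynomial.X ^ 2 * α = 0 := by linear_combination h₃
    exact (mul_eq_zero.mp this).resolve_left (mul_ne_zero two_ne_zero (pow_ne_zero _ hX))
  rw [hγ, hα, hβ]
  simp

lemma rank_D [CharZero k] : rank (D k) = 3 := by
  have h (φ : B k ≃ₐ[Polynomial k] B k) :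
      Set.ncard {i : Fin 3 | D k (φ (MvPolynomial.X i)) ≠ 0} = 3 := by
    have : {i : Fin 3 | D k (φ (MvPolynomial.X i)) ≠ 0} = Set.univ :=
      Set.eq_univ_of_forall fun i hi => homogeneousComponent_one_automorphism_ne_zero φ i
        (eq_zero_of_mem_kernel_of_isHomogeneous_one k
          (derivation_homogeneousComponent_eq_zero (isHomogeneousOfDegree_D k).2 hi 1)
          (MvPolynomial.homogeneousComponent_isHomogeneous _ _))
    rw [this, Set.ncard_univ, Nat.card_eq_fintype_card, Fintype.card_fin]
  have : {r : ℕ | ∃ φ : B k ≃ₐ[Polynomial k] B k,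
      Set.ncard {i : Fin 3 | D k (φ (MvPolynomial.X i)) ≠ 0} = r} = {3} := by
    ext r
    exact ⟨fun ⟨φ, hφ⟩ => hφ.symm.trans (h φ), fun hr => ⟨AlgEquiv.refl, (h _).trans hr.symm⟩⟩
  unfold rank
  rw [this, csInf_singleton]

end Homogeneous

/-! ### Substitution into polynomials in two variables. -/

section Bivariate

open Polynomial

variable {K A A' : Type*} [CommRing K] [CommRing A] [CommRing A'] [Algebra K A] [Algebra K A']

/-- The evaluation of a polynomial `p ∈ K[L][M]` at `L = f`, `M = g`. -/
def bieval (f g : A) : K[X][X] →ₐ[K] A :=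
  { eval₂RingHom (aeval f : K[X] →ₐ[K] A).toRingHom g with
    commutes' := fun r => by
      simp [Polynomial.algebraMap_apply] }

lemma bieval_apply (f g : A) (p : K[X][X]) :
    bieval f g p = eval₂ (aeval f : K[X] →ₐ[K] A).toRingHom g p := rfl

@[simp]
lemma bieval_C (f g : A) (p : K[X]) : bieval f g (C p) = aeval f p := by
  simp [bieval_apply]

@[simp]
lemma bieval_X (f g : A) : bieval (K := K) f g X = g := by
  simp [bieval_apply]

lemma map_bieval (φ : A →ₐ[K] A') (f g : A) (p : K[X][X]) :
    φ (bieval f g p) = bieval (φ f) (φ g) p := by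
  have h : φ.comp (bieval f g) = bieval (K := K) (φ f) (φ g) :=
    Polynomial.algHom_ext' (Polynomial.algHom_ext (by simp)) (by simp)
  exact DFunLike.congr_fun h p

lemma bieval_mem {S : Subalgebra K A} {f g : A} (hf : f ∈ S) (hg : g ∈ S) (p : K[X][X]) :
    bieval f g p ∈ S := by
  have h := map_bieval S.val ⟨f, hf⟩ ⟨g, hg⟩ p
  exact h ▸ (bieval (⟨f, hf⟩ : S) ⟨g, hg⟩ p).2

lemma comp_eq_zero_of_natDegree_ne_zero [IsDomain K] {p q : K[X]} (hq : q.natDegree ≠ 0)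
    (h : p.comp q = 0) : p = 0 :=
  (comp_eq_zero_iff.mp h).resolve_right fun h' => hq (h'.2 ▸ natDegree_C _)

/-- Substituting a nonconstant `g` for `M` is injective, so `p(0, M) = 0`, which means that `L`
divides `p`. -/
lemma C_X_dvd_of_bieval_zero_left [IsDomain K] {g : K[X]} (hg : g.natDegree ≠ 0) {p : K[X][X]}
    (h : bieval 0 g p = 0) : C X ∣ p := by
  have h' : (p.map (evalRingHom 0)).comp g = bieval 0 g p := by
    rw [Polynomial.comp, eval₂_map, bieval_apply]
    congr 1
    ext <;> simp
  rw [h] at h'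
  have hp := comp_eq_zero_of_natDegree_ne_zero hg h'
  rw [C_dvd_iff_dvd_coeff]
  intro i
  have := congrArg (fun q => q.coeff i) hp
  simpa [X_dvd_iff, coeff_map, coeff_zero_eq_eval_zero] using this

lemma X_dvd_of_bieval_zero_right [IsDomain K] {f : K[X]} (hf : f.natDegree ≠ 0) {p : K[X][X]}
    (h : bieval f 0 p = 0) : X ∣ p := by
  rw [X_dvd_iff]
  refine comp_eq_zero_of_natDegree_ne_zero hf ?_
  rw [← h, bieval_apply, eval₂_at_zero]
  rfl

lemma bieval_C_C_mul_X (f g : K[X]) (p : K[X][X]) :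
    bieval (C f) (C g * X) p = (p.map (compRingHom f)).comp (C g * X) := by
  rw [Polynomial.comp, eval₂_map, bieval_apply]
  congr 1
  ext <;> simp

/-- The coefficient of `Xⁱ` in the image is `pᵢ(f) gⁱ`, so each `pᵢ` can be recovered separately. -/
lemma bieval_C_C_mul_X_injective [IsDomain K] {f g : K[X]} (hf : f.natDegree ≠ 0) (hg : g ≠ 0)
    {p : K[X][X]} (h : bieval (C f) (C g * X) p = 0) : p = 0 := by
  rw [bieval_C_C_mul_X] at h
  ext1 i
  have := congrArg (fun q => q.coeff i) h
  simp only [comp_C_mul_X_coeff, coeff_map, coeff_zero] at this ⊢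
  exact comp_eq_zero_of_natDegree_ne_zero hf
    ((mul_eq_zero.mp this).resolve_right (pow_ne_zero _ hg))

lemma mem_of_pow_mul_mem {S : Subalgebra K A} {a : A} (ha : ∀ c, a * c ∈ S → c ∈ S) (n : ℕ)
    {c : A} (h : a ^ n * c ∈ S) : c ∈ S := by
  induction n generalizing c with
  | zero => simpa using h
  | succ n ih => exact ha _ (ih (by rwa [← mul_assoc, ← pow_succ]))

end Bivariate

/-! ### Cancelling `F` and `G` in `R[F, G]`, and inverting `tFG`. -/

section Saturation

variable (k : Type*) [Field k]

/-- The subalgebra `R[F, G]` of `B`, as the image of `R[L][M]`. -/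
def subalgebraFG : Subalgebra (Polynomial k) (B k) :=
  (bieval (K := Polynomial k) (F k) (G k)).range

lemma F_mem_subalgebraFG : F k ∈ subalgebraFG k := ⟨Polynomial.C Polynomial.X, by simp⟩

lemma G_mem_subalgebraFG : G k ∈ subalgebraFG k := ⟨Polynomial.X, by simp⟩

lemma t_mem_subalgebraFG : t k ∈ subalgebraFG k := (subalgebraFG k).algebraMap_mem Polynomial.X

lemma subalgebraFG_le_kernel : subalgebraFG k ≤ kernel (D k) := by
  rintro _ ⟨p, rfl⟩
  exact bieval_mem (S := kernel (D k)) (D_F k) (D_G k) p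

lemma mem_subalgebraFG_of_F_mul {c : B k} (h : F k * c ∈ subalgebraFG k) :
    c ∈ subalgebraFG k := by
  obtain ⟨p, hp⟩ := h
  -- A curve inside `F = 0`, given by `tz + x = 0` and `y = 0`, on which `G = x⁵` is nonconstant.
  let θ : B k →ₐ[Polynomial k] Polynomial (Polynomial k) :=
    MvPolynomial.aeval ![Polynomial.C Polynomial.X * Polynomial.X, 0, -Polynomial.X]
  have hF : θ (F k) = 0 := by
    simp [θ, F, x, y, z, t]
    ring
  have hG : θ (G k) = Polynomial.C (Polynomial.X ^ 5) * Polynomial.X ^ 5 := by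
    rw [G]
    simp only [map_add, map_mul, map_pow, hF]
    simp [θ, x, mul_pow]
  have h0 : θ (F k * c) = 0 := by rw [map_mul, hF, zero_mul]
  have hp' : bieval (F k) (G k) p = F k * c := hp
  rw [← hp', map_bieval, hF, hG] at h0
  obtain ⟨q, rfl⟩ := C_X_dvd_of_bieval_zero_left
    (by rw [Polynomial.natDegree_C_mul_X_pow _ _ (pow_ne_zero _ Polynomial.X_ne_zero)]; norm_num)
    h0
  rw [map_mul, bieval_C, Polynomial.aeval_X] at hp'
  exact ⟨q, mul_left_cancel₀ (F_ne_zero k) hp'⟩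

lemma mem_subalgebraFG_of_G_mul [CharZero k] {c : B k} (h : G k * c ∈ subalgebraFG k) :
    c ∈ subalgebraFG k := by
  obtain ⟨p, hp⟩ := h
  -- The line `x = z = 0` lies in `G = 0`, and `F = -t²y²` is nonconstant on it.
  let θ : B k →ₐ[Polynomial k] Polynomial (Polynomial k) :=
    MvPolynomial.aeval ![0, Polynomial.X, 0]
  have hF : θ (F k) = Polynomial.C (-Polynomial.X ^ 2) * Polynomial.X ^ 2 := by
    simp [θ, F, x, y, z, t]
    ring
  have hG : θ (G k) = 0 := by simp [θ, G, x, z]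
  have h0 : θ (G k * c) = 0 := by rw [map_mul, hG, zero_mul]
  have hp' : bieval (F k) (G k) p = G k * c := hp
  rw [← hp', map_bieval, hF, hG] at h0
  obtain ⟨q, rfl⟩ := X_dvd_of_bieval_zero_right
    (by rw [Polynomial.natDegree_C_mul_X_pow _ _
      (neg_ne_zero.mpr (pow_ne_zero _ Polynomial.X_ne_zero))]; norm_num)
    h0
  rw [map_mul, bieval_X] at hp'
  exact ⟨q, mul_left_cancel₀ (G_ne_zero k) hp'⟩

/-- `F` and `G` are algebraically independent over `R`. -/
lemma bieval_F_G_injective {p : Polynomial (Polynomial (Polynomial k))}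
    (h : bieval (F k) (G k) p = 0) : p = 0 := by
  -- On the plane `x = 0`, `F = -t²y²` is free of `z` and `G = t⁵y⁴z` is linear in `z`.
  let θ : B k →ₐ[Polynomial k] Polynomial (Polynomial (Polynomial k)) :=
    MvPolynomial.aeval ![0, Polynomial.C (Polynomial.X : Polynomial (Polynomial k)), Polynomial.X]
  let τ : Polynomial k := Polynomial.X
  have hF : θ (F k) = Polynomial.C (Polynomial.C (-τ ^ 2) * Polynomial.X ^ 2) := by
    simp [θ, τ, F, x, y, z, t, Polynomial.algebraMap_apply]
    ring
  have hG : θ (G k) =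
      Polynomial.C (Polynomial.C (τ ^ 5) * Polynomial.X ^ 4) * Polynomial.X := by
    rw [G]
    simp only [map_add, map_mul, map_pow, hF]
    simp [θ, τ, x, z, t, Polynomial.algebraMap_apply]
    ring
  have h0 : θ (bieval (F k) (G k) p) = 0 := by rw [h, map_zero]
  have h1 := (map_bieval (K := Polynomial k) (A' := Polynomial (Polynomial (Polynomial k)))
    θ (F k) (G k) p).symm.trans h0
  rw [hF, hG] at h1
  have hτ : τ ≠ 0 := Polynomial.X_ne_zero
  refine bieval_C_C_mul_X_injective ?_ ?_ h1
  · rw [Polynomial.natDegree_C_mul_X_pow _ _ (neg_ne_zero.mpr (pow_ne_zero _ hτ))]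
    norm_num
  · exact mul_ne_zero (Polynomial.C_ne_zero.mpr (pow_ne_zero _ hτ))
      (pow_ne_zero _ Polynomial.X_ne_zero)

/-- The subalgebra of those `b` with `(t F G)ⁿ b ∈ R[F, G][P]` for some `n`. -/
def localizedSlice : Subalgebra (Polynomial k) (B k) where
  carrier := {b | ∃ (n : ℕ) (q : Polynomial (subalgebraFG k)),
    (t k * F k * G k) ^ n * b = Polynomial.aeval (P k) q}
  mul_mem' := by
    rintro a b ⟨m, p, hp⟩ ⟨n, q, hq⟩
    exact ⟨m + n, p * q, by rw [map_mul, ← hp, ← hq]; ring⟩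
  add_mem' := by
    rintro a b ⟨m, p, hp⟩ ⟨n, q, hq⟩
    let d : subalgebraFG k := ⟨t k * F k * G k, mul_mem (mul_mem (t_mem_subalgebraFG k)
      (F_mem_subalgebraFG k)) (G_mem_subalgebraFG k)⟩
    refine ⟨m + n, Polynomial.C (d ^ n) * p + Polynomial.C (d ^ m) * q, ?_⟩
    have hd : algebraMap (subalgebraFG k) (B k) d = t k * F k * G k := rfl
    rw [map_add, map_mul, map_mul, ← hp, ← hq, Polynomial.aeval_C, Polynomial.aeval_C, map_pow,
      map_pow, hd]
    ring
  algebraMap_mem' r := ⟨0, Polynomial.C (algebraMap _ _ r), by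
    rw [pow_zero, one_mul, Polynomial.aeval_C]; rfl⟩

lemma subalgebraFG_le_localizedSlice : subalgebraFG k ≤ localizedSlice k := fun s hs =>
  ⟨0, Polynomial.C ⟨s, hs⟩, by rw [pow_zero, one_mul, Polynomial.aeval_C]; rfl⟩

lemma P_mem_localizedSlice : P k ∈ localizedSlice k := ⟨0, Polynomial.X, by simp⟩

lemma mem_localizedSlice_of_mul {b : B k} (h : t k * F k * G k * b ∈ localizedSlice k) :
    b ∈ localizedSlice k := by
  obtain ⟨n, q, hq⟩ := h
  exact ⟨n + 1, q, by rw [← hq]; ring⟩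

lemma localizedSlice_eq_top : localizedSlice k = ⊤ := by
  have ht := subalgebraFG_le_localizedSlice k (t_mem_subalgebraFG k)
  have hF := subalgebraFG_le_localizedSlice k (F_mem_subalgebraFG k)
  have hG := subalgebraFG_le_localizedSlice k (G_mem_subalgebraFG k)
  have hP := P_mem_localizedSlice k
  have hx : x k ∈ localizedSlice k := by
    refine mem_localizedSlice_of_mul k ?_
    rw [show t k * F k * G k * x k = t k * F k * (F k ^ 3 + P k ^ 2) by rw [← x_mul_G]; ring]
    exact mul_mem (mul_mem ht hF) (add_mem (pow_mem hF 3) (pow_mem hP 2))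
  have hy : y k ∈ localizedSlice k := by
    refine mem_localizedSlice_of_mul k ?_
    rw [show t k * F k * G k * y k = G k * (P k - x k ^ 3) by rw [← t_mul_F_mul_y]; ring]
    exact mul_mem hG (sub_mem hP (pow_mem hx 3))
  have hz : z k ∈ localizedSlice k := by
    -- Two factors `tFG` are needed because `z` appears with the coefficient `tF²`.
    refine mem_localizedSlice_of_mul k (mem_localizedSlice_of_mul k ?_)
    rw [show t k * F k * G k * (t k * F k * G k * z k) = t k * G k ^ 2 *
        (G k - (t k * F k * (x k * x k * y k) + t k * F k * (x k * x k * y k)) - x k ^ 5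
          - F k ^ 2 * x k) by linear_combination t k * G k ^ 2 * t_mul_F_sq_mul_z k]
    have hxy := mul_mem (mul_mem ht hF) (mul_mem (mul_mem hx hx) hy)
    exact mul_mem (mul_mem ht (pow_mem hG 2)) (sub_mem (sub_mem (sub_mem hG (add_mem hxy hxy))
      (pow_mem hx 5)) (mul_mem (pow_mem hF 2) hx))
  rw [eq_top_iff]
  intro p _
  induction p using MvPolynomial.induction_on with
  | C r => exact (localizedSlice k).algebraMap_mem r
  | add p q hp hq => exact add_mem (hp trivial) (hq trivial)
  | mul_X p i hp =>
    refine mul_mem (hp trivial) ?_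
    fin_cases i
    exacts [hx, hy, hz]

lemma exists_t_pow_mul_mem_of_mem_kernel [CharZero k] {b : B k} (hb : D k b = 0) :
    ∃ n : ℕ, t k ^ n * b ∈ subalgebraFG k := by
  obtain ⟨n, q, hq⟩ : b ∈ localizedSlice k := localizedSlice_eq_top k ▸ trivial
  have hP : D k (P k) ≠ 0 := by
    rw [D_P]
    exact mul_ne_zero (mul_ne_zero (neg_ne_zero.mpr (pow_ne_zero _ (t_ne_zero k))) (F_ne_zero k))
      (G_ne_zero k)
  have hD : D k (Polynomial.aeval (P k) q) = 0 := by
    rw [← hq]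
    simp [Derivation.leibniz, Derivation.leibniz_pow, D_t, D_F, D_G, hb]
  have hmem := aeval_mem_of_mem_kernel (D k) (subalgebraFG_le_kernel k) hP q hD
  rw [← hq, show (t k * F k * G k) ^ n * b = F k ^ n * (G k ^ n * (t k ^ n * b)) by ring] at hmem
  exact ⟨n, mem_of_pow_mul_mem (fun _ => mem_subalgebraFG_of_G_mul k) n
    (mem_of_pow_mul_mem (fun _ => mem_subalgebraFG_of_F_mul k) n hmem)⟩

end Saturation

/-! ### Reduction modulo `t`, generators and presentation of the kernel. -/

section SpecialFibre

open Polynomial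

/-- The first summand is even and the second odd in `X`; the substitution `X ↦ -X` separates them.
-/
lemma eq_zero_of_comp_sq_add {K : Type*} [CommRing K] [IsDomain K] [CharZero K] {p q : K[X]}
    {m : ℕ} (hm : Odd m) (h : p.comp (X ^ 2) + 2 * X ^ m * q.comp (X ^ 2) = 0) :
    p = 0 ∧ q = 0 := by
  have h' := congrArg (fun r => r.comp (-X)) h
  simp only [add_comp, mul_comp, comp_assoc, X_pow_comp, zero_comp, even_two.neg_pow, hm.neg_pow,
    ofNat_comp] at h'
  have hp : 2 * p.comp (X ^ 2) = 0 := by linear_combination h + h'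
  have hq : 2 * (2 * X ^ m) * q.comp (X ^ 2) = 0 := by linear_combination h - h'
  have hX : (X ^ 2 : K[X]).natDegree ≠ 0 := by simp
  refine ⟨comp_eq_zero_of_natDegree_ne_zero hX ((mul_eq_zero.mp hp).resolve_left two_ne_zero),
    comp_eq_zero_of_natDegree_ne_zero hX ((mul_eq_zero.mp hq).resolve_left ?_)⟩
  exact mul_ne_zero two_ne_zero (mul_ne_zero two_ne_zero (pow_ne_zero _ X_ne_zero))

variable (k : Type*) [Field k]

/-- The reduction of `B` modulo `t` and `z`, with values in `k[x][y]`. -/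
def specialFibre : B k →ₐ[k] k[X][X] :=
  { MvPolynomial.eval₂Hom ((C.comp C).comp (evalRingHom 0)) ![C X, X, 0] with
    commutes' := fun r => by
      simp [MvPolynomial.algebraMap_apply, Polynomial.algebraMap_apply] }

lemma specialFibre_apply (b : B k) : specialFibre k b =
    MvPolynomial.eval₂Hom ((C.comp C).comp (evalRingHom 0)) ![C X, X, 0] b := rfl

lemma specialFibre_t : specialFibre k (t k) = 0 := by simp [specialFibre_apply, t]

lemma specialFibre_x : specialFibre k (x k) = C X := by simp [specialFibre_apply, x]

lemma specialFibre_y : specialFibre k (y k) = X := by simp [specialFibre_apply, y]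

lemma specialFibre_z : specialFibre k (z k) = 0 := by simp [specialFibre_apply, z]

lemma specialFibre_F : specialFibre k (F k) = C (X ^ 2) := by
  simp [F, specialFibre_t, specialFibre_x, pow_two]

lemma specialFibre_G : specialFibre k (G k) = C (2 * X ^ 5) := by
  have h2 : (C 2 : k[X][X]) = 2 := map_ofNat C 2
  simp [h2, G, specialFibre_t, specialFibre_x, specialFibre_F]
  ring

lemma specialFibre_H : specialFibre k (H k) = C (8 * X ^ 9) * X := by
  have h2 : specialFibre k 2 = 2 := map_ofNat (specialFibre k) 2
  have h4 : specialFibre k 4 = 4 := map_ofNat (specialFibre k) 4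
  have h8 : (C 8 : k[X][X]) = 8 := map_ofNat C 8
  simp [h2, h4, h8, H, G₁, F₁, specialFibre_t, specialFibre_x, specialFibre_y, specialFibre_z, specialFibre_F]
  ring

/-- The homomorphism `k[t, L, M, N] → B` with `t, L, M, N ↦ t, F, G, H`. -/
def kernelMap : MvPolynomial (Fin 4) k →ₐ[k] B k :=
  MvPolynomial.aeval ![t k, F k, G k, H k]

@[simp]
lemma kernelMap_X (i : Fin 4) : kernelMap k (MvPolynomial.X i) = ![t k, F k, G k, H k] i := by
  simp [kernelMap]

lemma kernelMap_relation : kernelMap k (relation k) = 0 := by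
  have h4 : kernelMap k 4 = 4 := map_ofNat (kernelMap k) 4
  simp [relation, h4]
  linear_combination -G_sq_sub k

/-- Normal forms modulo `t` and the relation between `t, F, G, H`. -/
lemma exists_normal_form (p : MvPolynomial (Fin 4) k) :
    ∃ (a b : k[X][X]) (q r : MvPolynomial (Fin 4) k),
      p = bieval (MvPolynomial.X 1) (MvPolynomial.X 3) a
        + MvPolynomial.X 2 * bieval (MvPolynomial.X 1) (MvPolynomial.X 3) b
        + MvPolynomial.X 0 * q + relation k * r := by
  induction p using MvPolynomial.induction_on with
  | C c =>
    refine ⟨C (C c), 0, 0, 0, ?_⟩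
    simp [MvPolynomial.algebraMap_eq]
  | add p₁ p₂ h₁ h₂ =>
    obtain ⟨a₁, b₁, q₁, r₁, h₁⟩ := h₁
    obtain ⟨a₂, b₂, q₂, r₂, h₂⟩ := h₂
    refine ⟨a₁ + a₂, b₁ + b₂, q₁ + q₂, r₁ + r₂, ?_⟩
    rw [map_add, map_add]
    linear_combination h₁ + h₂
  | mul_X p i h =>
    obtain ⟨a, b, q, r, h⟩ := h
    have hi : i = 0 ∨ i = 1 ∨ i = 2 ∨ i = 3 := by fin_cases i <;> simp
    obtain rfl | rfl | rfl | rfl := hi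
    · exact ⟨0, 0, p, 0, by simp [mul_comm]⟩
    · refine ⟨C X * a, C X * b, MvPolynomial.X 1 * q, MvPolynomial.X 1 * r, ?_⟩
      rw [map_mul, map_mul, bieval_C, aeval_X]
      linear_combination MvPolynomial.X 1 * h
    -- The new factor `M²` is rewritten as `4L⁵ + tN` minus the relation.
    · refine ⟨C (4 * X ^ 5) * b, a, MvPolynomial.X 2 * q + MvPolynomial.X 3 *
        bieval (MvPolynomial.X 1) (MvPolynomial.X 3) b, MvPolynomial.X 2 * r -
        bieval (MvPolynomial.X 1) (MvPolynomial.X 3) b, ?_⟩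
      rw [map_mul, bieval_C, map_mul, map_pow, aeval_X, map_ofNat, relation]
      rw [relation] at h
      linear_combination MvPolynomial.X 2 * h
    · refine ⟨X * a, X * b, MvPolynomial.X 3 * q, MvPolynomial.X 3 * r, ?_⟩
      rw [map_mul, map_mul, bieval_X]
      linear_combination MvPolynomial.X 3 * h

/-- The special fibre of `k[t, F, G, H]` is presented by the special fibre of the relation. -/
lemma exists_of_specialFibre_kernelMap_eq_zero [CharZero k] {p : MvPolynomial (Fin 4) k}
    (h : specialFibre k (kernelMap k p) = 0) :
    ∃ q r, p = MvPolynomial.X 0 * q + relation k * r := by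
  obtain ⟨a, b, q, r, rfl⟩ := exists_normal_form k p
  have hbi (a : k[X][X]) :
      specialFibre k (kernelMap k (bieval (MvPolynomial.X 1) (MvPolynomial.X 3) a)) =
        bieval (specialFibre k (F k)) (specialFibre k (H k)) a := by
    rw [map_bieval (kernelMap k), kernelMap_X, kernelMap_X]
    exact map_bieval (K := k) (specialFibre k) (F k) (H k) a
  have h2 : kernelMap k (MvPolynomial.X 2) = G k := kernelMap_X k 2
  have h0 : kernelMap k (MvPolynomial.X 0) = t k := kernelMap_X k 0
  simp only [map_add, map_mul, kernelMap_relation, zero_mul, add_zero, hbi, h0, h2] at h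
  rw [specialFibre_t, zero_mul, add_zero, specialFibre_F, specialFibre_G, specialFibre_H,
    bieval_C_C_mul_X, bieval_C_C_mul_X] at h
  -- The coefficient of `yʲ` is `(aⱼ(x²) + 2x⁵ bⱼ(x²)) (8x⁹)ʲ`, to which the parity argument
  -- applies.
  have hj (j : ℕ) : a.coeff j = 0 ∧ b.coeff j = 0 := by
    have := congrArg (fun f => f.coeff j) h
    simp only [coeff_add, coeff_C_mul, comp_C_mul_X_coeff, coeff_map, coeff_zero,
      coe_compRingHom_apply] at this
    refine eq_zero_of_comp_sq_add (m := 5) (by decide) ?_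
    have h8 : (8 * X ^ 9 : k[X]) ^ j ≠ 0 :=
      pow_ne_zero _ (mul_ne_zero (by norm_num) (pow_ne_zero _ X_ne_zero))
    refine (mul_eq_zero.mp (?_ : _ * (8 * X ^ 9 : k[X]) ^ j = 0)).resolve_right h8
    linear_combination this
  have ha : a = 0 := Polynomial.ext fun j => (hj j).1
  have hb : b = 0 := Polynomial.ext fun j => (hj j).2
  exact ⟨q, r, by rw [ha, hb, map_zero]; ring⟩

/-- A preimage of `tc` vanishes on the special fibre, so it is a multiple of the variable `t` modulo
the relation, and that factor cancels. -/
lemma mem_range_kernelMap_of_t_mul [CharZero k] {c : B k} (h : t k * c ∈ (kernelMap k).range) :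
    c ∈ (kernelMap k).range := by
  obtain ⟨p, hp⟩ := h
  have hp' : kernelMap k p = t k * c := hp
  obtain ⟨q, r, rfl⟩ := exists_of_specialFibre_kernelMap_eq_zero k (p := p)
    (by rw [hp', map_mul, specialFibre_t, zero_mul])
  rw [map_add, map_mul, map_mul, kernelMap_relation, zero_mul, add_zero, kernelMap_X] at hp'
  exact ⟨q, mul_left_cancel₀ (t_ne_zero k) hp'⟩

lemma subalgebraFG_subset_range_kernelMap {b : B k} (hb : b ∈ subalgebraFG k) :
    b ∈ (kernelMap k).range := by
  have ht : t k ∈ (kernelMap k).range := ⟨MvPolynomial.X 0, kernelMap_X k 0⟩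
  have hF : F k ∈ (kernelMap k).range := ⟨MvPolynomial.X 1, kernelMap_X k 1⟩
  have hG : G k ∈ (kernelMap k).range := ⟨MvPolynomial.X 2, kernelMap_X k 2⟩
  let S : Subalgebra (Polynomial k) (B k) :=
    { (kernelMap k).range with
      algebraMap_mem' := fun r => by
        have hr : algebraMap (Polynomial k) (B k) r = aeval (t k) r := by
          have : (IsScalarTower.toAlgHom k k[X] (B k)) = aeval (t k) :=
            Polynomial.algHom_ext (by simp [t, MvPolynomial.algebraMap_eq])
          exact DFunLike.congr_fun this r
        rw [hr]
        exact Algebra.adjoin_le (Set.singleton_subset_iff.mpr ht)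
          (aeval_mem_adjoin_singleton k (t k)) }
  obtain ⟨p, rfl⟩ := hb
  exact bieval_mem (S := S) hF hG p

lemma D_kernelMap (p : MvPolynomial (Fin 4) k) : D k (kernelMap k p) = 0 := by
  have hH : D k (H k) = 0 := by
    have h := congrArg (D k) (G_sq_sub k)
    rw [map_sub, Derivation.leibniz_pow, D_G, Derivation.leibniz, Derivation.leibniz_pow, D_F,
      (show D k 4 = 0 from (D k).map_natCast 4), Derivation.leibniz, D_t] at h
    simp only [smul_zero, sub_zero, add_zero, smul_eq_mul, mul_zero] at h
    exact (mul_eq_zero.mp h.symm).resolve_left (t_ne_zero k)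
  induction p using MvPolynomial.induction_on with
  | C c =>
    rw [← MvPolynomial.algebraMap_eq, AlgHom.commutes,
      IsScalarTower.algebraMap_apply k (Polynomial k) (B k)]
    exact (D k).map_algebraMap _
  | add p q hp hq => rw [map_add, map_add, hp, hq, add_zero]
  | mul_X p i hp =>
    have hi : D k (![t k, F k, G k, H k] i) = 0 := by
      fin_cases i
      exacts [D_t k, D_F k, D_G k, hH]
    rw [map_mul, Derivation.leibniz, hp, kernelMap_X, hi, smul_zero, smul_zero, add_zero]

lemma mem_range_kernelMap_iff [CharZero k] {b : B k} : b ∈ (kernelMap k).range ↔ D k b = 0 := by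
  refine ⟨fun ⟨p, hp⟩ => hp ▸ D_kernelMap k p, fun hb => ?_⟩
  obtain ⟨n, hn⟩ := exists_t_pow_mul_mem_of_mem_kernel k hb
  exact mem_of_pow_mul_mem (fun _ => mem_range_kernelMap_of_t_mul k) n
    (subalgebraFG_subset_range_kernelMap k hn)

/-- The homomorphism `k[t][L][M] → k[t, L, M, N]`. -/
def inclusionLM : k[X][X][X] →+* MvPolynomial (Fin 4) k :=
  eval₂RingHom (eval₂RingHom (aeval (R := k) (MvPolynomial.X 0 : MvPolynomial (Fin 4) k)).toRingHom
    (MvPolynomial.X 1)) (MvPolynomial.X 2)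

lemma kernelMap_inclusionLM (p : k[X][X][X]) :
    kernelMap k (inclusionLM k p) = bieval (F k) (G k) p := by
  have h : (kernelMap k).toRingHom.comp (inclusionLM k) = (bieval (F k) (G k)).toRingHom := by
    ext <;> simp [inclusionLM, t, MvPolynomial.algebraMap_eq]
  exact DFunLike.congr_fun h p

/-- The relation lets one eliminate `N` after inverting `t`. -/
lemma exists_X_zero_pow_mul_eq (p : MvPolynomial (Fin 4) k) :
    ∃ (n : ℕ) (a : k[X][X][X]) (r : MvPolynomial (Fin 4) k),
      MvPolynomial.X 0 ^ n * p = inclusionLM k a + relation k * r := by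
  have h₀ : inclusionLM k (C (C X)) = MvPolynomial.X 0 := by simp [inclusionLM]
  have h₁ : inclusionLM k (C X) = MvPolynomial.X 1 := by simp [inclusionLM]
  have h₂ : inclusionLM k X = MvPolynomial.X 2 := by simp [inclusionLM]
  induction p using MvPolynomial.induction_on with
  | C c =>
    refine ⟨0, C (C (C c)), 0, ?_⟩
    simp [inclusionLM, MvPolynomial.algebraMap_eq]
  | add p₁ p₂ hp₁ hp₂ =>
    obtain ⟨m, a₁, r₁, hp₁⟩ := hp₁
    obtain ⟨n, a₂, r₂, hp₂⟩ := hp₂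
    refine ⟨m + n, C (C X) ^ n * a₁ + C (C X) ^ m * a₂,
      MvPolynomial.X 0 ^ n * r₁ + MvPolynomial.X 0 ^ m * r₂, ?_⟩
    rw [map_add, map_mul, map_mul, map_pow, map_pow, h₀]
    linear_combination MvPolynomial.X 0 ^ n * hp₁ + MvPolynomial.X 0 ^ m * hp₂
  | mul_X p i hp =>
    obtain ⟨n, a, r, hp⟩ := hp
    have hi : i = 0 ∨ i = 1 ∨ i = 2 ∨ i = 3 := by fin_cases i <;> simp
    obtain rfl | rfl | rfl | rfl := hi
    · refine ⟨n, C (C X) * a, MvPolynomial.X 0 * r, ?_⟩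
      rw [map_mul, h₀]
      linear_combination MvPolynomial.X 0 * hp
    · refine ⟨n, C X * a, MvPolynomial.X 1 * r, ?_⟩
      rw [map_mul, h₁]
      linear_combination MvPolynomial.X 1 * hp
    · refine ⟨n, X * a, MvPolynomial.X 2 * r, ?_⟩
      rw [map_mul, h₂]
      linear_combination MvPolynomial.X 2 * hp
    · have h₄ : inclusionLM k (C (C (C (-4)))) = -4 := by
        simp [inclusionLM, map_ofNat (MvPolynomial.C : k →+* MvPolynomial (Fin 4) k) 4]
      -- One more power of `t` turns `N` into `tN`, which is `M² - 4L⁵` plus the relation.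
      refine ⟨n + 1, (X ^ 2 + C (C (C (-4))) * C X ^ 5) * a,
        MvPolynomial.X 0 * MvPolynomial.X 3 * r + inclusionLM k a, ?_⟩
      rw [map_mul, map_add, map_mul, map_pow, map_pow, h₁, h₂, h₄, relation]
      rw [relation] at hp
      linear_combination MvPolynomial.X 0 * MvPolynomial.X 3 * hp

lemma kernelMap_eq_zero_iff [CharZero k] {p : MvPolynomial (Fin 4) k} :
    kernelMap k p = 0 ↔ relation k ∣ p := by
  refine ⟨fun h => ?_, fun ⟨q, hq⟩ => by rw [hq, map_mul, kernelMap_relation, zero_mul]⟩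
  obtain ⟨n, a, r, hp⟩ := exists_X_zero_pow_mul_eq k p
  have ha : a = 0 := by
    refine bieval_F_G_injective k ?_
    have := congrArg (kernelMap k) hp
    rw [map_mul, h, mul_zero, map_add, map_mul, kernelMap_relation, zero_mul, add_zero,
      kernelMap_inclusionLM] at this
    exact this.symm
  rw [ha, map_zero, zero_add] at hp
  have hrel : ¬ (MvPolynomial.X 0 : MvPolynomial (Fin 4) k) ∣ relation k := by
    rintro ⟨q, hq⟩
    -- At this point `t` vanishes while the relation takes the value `3`.
    have := congrArg (MvPolynomial.eval ![0, 1, 1, 0]) hq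
    simp [relation] at this
    norm_num at this
  obtain ⟨q, hq⟩ := (MvPolynomial.X_prime (R := k) (i := (0 : Fin 4))).pow_dvd_of_dvd_mul_left n
    hrel ⟨p, hp.symm⟩
  refine ⟨q, mul_left_cancel₀ (pow_ne_zero n (MvPolynomial.X_ne_zero (R := k) (0 : Fin 4))) ?_⟩
  rw [hp, hq]
  ring

lemma insert_eq_range_vec {α : Type*} (a b c d : α) :
    ({a, b, c, d} : Set α) = Set.range ![a, b, c, d] := by
  ext e
  simp
  tauto

lemma kernel_restrictScalars_eq_adjoin [CharZero k] :
    (kernel (D k)).restrictScalars k = Algebra.adjoin k {t k, F k, G k, H k} := by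
  rw [insert_eq_range_vec, Algebra.adjoin_range_eq_range_aeval]
  ext b
  exact (mem_range_kernelMap_iff k).symm

lemma exists_kernel_algEquiv [CharZero k] :
    ∃ φ : (MvPolynomial (Fin 4) k ⧸ Ideal.span {relation k}) ≃ₐ[k] kernel (D k),
      ∀ i : Fin 4, (φ (Ideal.Quotient.mk (Ideal.span {relation k}) (MvPolynomial.X i)) : B k) =
        ![t k, F k, G k, H k] i := by
  let f : MvPolynomial (Fin 4) k →ₐ[k] kernel (D k) :=
    MvPolynomial.aeval fun i => ⟨kernelMap k (MvPolynomial.X i), D_kernelMap k _⟩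
  have hf (p : MvPolynomial (Fin 4) k) : (f p : B k) = kernelMap k p := by
    have : ((kernel (D k)).val.restrictScalars k).comp f = kernelMap k :=
      MvPolynomial.algHom_ext fun i => by simp [f]
    exact DFunLike.congr_fun this p
  have hsurj : Function.Surjective f := fun b => by
    obtain ⟨p, hp⟩ := (mem_range_kernelMap_iff k).mpr b.2
    exact ⟨p, Subtype.ext ((hf p).trans hp)⟩
  have hker : Ideal.span {relation k} = RingHom.ker f := by
    ext p
    rw [Ideal.mem_span_singleton, ← kernelMap_eq_zero_iff, RingHom.mem_ker, ← hf]
    exact ZeroMemClass.coe_eq_zero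
  refine ⟨(Ideal.quotientEquivAlgOfEq k hker).trans
    (Ideal.quotientKerAlgEquivOfSurjective hsurj), fun i => ?_⟩
  rw [← kernelMap_X, ← hf]
  rfl

end SpecialFibre

/-! ### The kernel is not a polynomial ring over `R`. -/

section NotPolynomial

open Polynomial

variable (k : Type*) [Field k]

/-- The reduction of `B` modulo `t`, `y` and `z`, with values in `k[x]`. -/
def specialLine : B k →+* k[X] :=
  (evalRingHom 0).comp (specialFibre k).toRingHom

lemma specialLine_apply (b : B k) : specialLine k b = (specialFibre k b).eval 0 := rfl

/-- The generators `t, F, G, H` restrict to `0, x², 2x⁵, 0`, so no kernel element acquires a linear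
term. -/
lemma coeff_one_specialLine_of_mem_kernel [CharZero k] {b : B k} (hb : D k b = 0) :
    (specialLine k b).coeff 1 = 0 := by
  obtain ⟨p, rfl⟩ := (mem_range_kernelMap_iff k).mpr hb
  change (specialLine k (kernelMap k p)).coeff 1 = 0
  induction p using MvPolynomial.induction_on with
  | C c =>
    rw [← MvPolynomial.algebraMap_eq, AlgHom.commutes, specialLine_apply, AlgHom.commutes]
    simp [Polynomial.algebraMap_apply]
  | add p q hp hq =>
    rw [map_add, map_add, coeff_add, hp (D_kernelMap k p), hq (D_kernelMap k q), add_zero]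
  | mul_X p i hp =>
    rw [map_mul, map_mul, kernelMap_X]
    have ht : specialLine k (t k) = 0 := by simp [specialLine_apply, specialFibre_t]
    have hF : specialLine k (F k) = X ^ 2 := by simp [specialLine_apply, specialFibre_F]
    have hG : specialLine k (G k) = 2 * X ^ 5 := by simp [specialLine_apply, specialFibre_G]
    have hH : specialLine k (H k) = 0 := by simp [specialLine_apply, specialFibre_H]
    fin_cases i
    · simp [ht]
    · simp [hF, coeff_mul_X_pow']
    · simp [hG, ← mul_assoc, coeff_mul_X_pow']
    · simp [hH]

lemma not_isPolynomialRing_kernel [CharZero k] :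
    ¬ IsPolynomialRing (Polynomial k) (kernel (D k)) 2 := by
  rintro ⟨φ⟩
  let ρ : MvPolynomial (Fin 2) k[X] →+* MvPolynomial (Fin 2) k := MvPolynomial.map (evalRingHom 0)
  let F' : kernel (D k) := ⟨F k, D_F k⟩
  let G' : kernel (D k) := ⟨G k, D_G k⟩
  let H' : kernel (D k) := ⟨H k, by
    have := D_kernelMap k (MvPolynomial.X 3)
    rwa [kernelMap_X] at this⟩
  let t' : kernel (D k) := algebraMap k[X] (kernel (D k)) X
  have hrel : G' ^ 2 = t' * H' + 4 * F' ^ 5 :=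
    Subtype.ext (sub_eq_iff_eq_add.mp (G_sq_sub k))
  -- Restriction to the special line factors through the reduction modulo `t` of the supposed
  -- polynomial ring.
  have hρ {a b : kernel (D k)} (hab : ρ (φ a) = ρ (φ b)) :
      specialLine k a = specialLine k b := by
    have hdvd : MvPolynomial.C X ∣ φ a - φ b := by
      rw [MvPolynomial.C_dvd_iff_dvd_coeff]
      intro i
      have := congrArg (MvPolynomial.coeff i) (sub_eq_zero.mpr hab)
      rw [← map_sub, MvPolynomial.coeff_map, MvPolynomial.coeff_zero] at this
      rwa [X_dvd_iff, coeff_zero_eq_eval_zero]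
    obtain ⟨w, hw⟩ := hdvd
    have ha : a = t' * φ.symm w + b := by
      apply φ.injective
      rw [map_add, map_mul, φ.apply_symm_apply, φ.commutes, sub_eq_iff_eq_add.mp hw]
      rfl
    have ht : specialLine k (t' : B k) = 0 :=
      (by simp [specialLine_apply, specialFibre_t] : specialLine k (t k) = 0)
    rw [ha, AddMemClass.coe_add, MulMemClass.coe_mul, map_add, map_mul, ht, zero_mul, zero_add]
  have hF : specialLine k (F' : B k) = X ^ 2 := by
    change specialLine k (F k) = X ^ 2
    simp [specialLine_apply, specialFibre_F]
  have hf : ρ (φ F') ≠ 0 := fun h => by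
    have h0 := hρ (a := F') (b := 0) (by rw [h, map_zero, map_zero])
    rw [hF, ZeroMemClass.coe_zero, map_zero] at h0
    exact pow_ne_zero 2 X_ne_zero h0
  have hfg : ρ (φ G') ^ 2 = (2 * ρ (φ F') ^ 2) ^ 2 * ρ (φ F') := by
    have h := congrArg (fun a => ρ (φ a)) hrel
    have ht : ρ (φ t') = 0 := by rw [φ.commutes]; simp [ρ, MvPolynomial.algebraMap_eq]
    have h4 : ρ (φ 4) = 4 := by rw [map_ofNat, map_ofNat]
    simp only [map_add, map_mul, map_pow, ht, h4, zero_mul] at h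
    linear_combination h
  -- With `f, g` the reductions of `F, G`, the equation `g² = (2f²)² f` gives `2f² ∣ g`, and the
  -- quotient `e` satisfies `e² = f`.
  obtain ⟨e, he⟩ := (IsIntegrallyClosed.pow_dvd_pow_iff two_ne_zero).mp
    (Dvd.intro _ hfg.symm)
  have hef : e ^ 2 = ρ (φ F') := by
    refine mul_left_cancel₀ (pow_ne_zero 2 (mul_ne_zero two_ne_zero (pow_ne_zero 2 hf))) ?_
    rw [← hfg, he]
    ring
  obtain ⟨q, hq⟩ := MvPolynomial.map_surjective (σ := Fin 2) (evalRingHom (0 : k))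
    (fun c => ⟨C c, by simp⟩) e
  have hq' : ρ q = e := hq
  have hE := hρ (a := φ.symm q ^ 2) (b := F') (by
    rw [map_pow, φ.apply_symm_apply, map_pow, hq', hef])
  have hsq : specialLine k (φ.symm q : B k) ^ 2 = X ^ 2 := by
    rw [← hF, ← hE, SubmonoidClass.coe_pow, map_pow]
  have hcoeff := coeff_one_specialLine_of_mem_kernel k (φ.symm q).2
  obtain h | h := sq_eq_sq_iff_eq_or_eq_neg.mp hsq <;> simp [h] at hcoeff

end NotPolynomial

end HomLND

end

theorem mainTheorem10 (k : Type*) [Field k] [CharZero k] :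
    -- `F`, `G`, `P` are homogeneous, and `D` is a homogeneous locally nilpotent `R`-derivation
    (HomLND.F k).IsHomogeneous 2 ∧ (HomLND.G k).IsHomogeneous 5 ∧ (HomLND.P k).IsHomogeneous 3 ∧
    HomLND.IsLocallyNilpotent (HomLND.D k) ∧
    HomLND.IsHomogeneousOfDegree (HomLND.D k) 4 ∧
    (HomLND.D k)^[3] (HomLND.x k) = 0 ∧
    (HomLND.D k)^[7] (HomLND.y k) = 0 ∧
    (HomLND.D k)^[11] (HomLND.z k) = 0 ∧
    -- the relation that defines `H`
    HomLND.G k ^ 2 - 4 * HomLND.F k ^ 5 = HomLND.t k * HomLND.H k ∧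
    -- the kernel is `k[t, F, G, H]`
    (HomLND.kernel (HomLND.D k)).restrictScalars k =
      Algebra.adjoin k {HomLND.t k, HomLND.F k, HomLND.G k, HomLND.H k} ∧
    -- it is `k[t, L, M, N] / (t N - M² + 4 L⁵)` through `t, L, M, N ↦ t, F, G, H`
    (∃ φ : (MvPolynomial (Fin 4) k ⧸ Ideal.span {HomLND.relation k}) ≃ₐ[k]
        HomLND.kernel (HomLND.D k),
      ∀ i : Fin 4,
        (φ (Ideal.Quotient.mk (Ideal.span {HomLND.relation k}) (MvPolynomial.X i)) : HomLND.B k) =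
          ![HomLND.t k, HomLND.F k, HomLND.G k, HomLND.H k] i) ∧
    -- it is not a polynomial ring in two variables over `R = k[t]`
    ¬ HomLND.IsPolynomialRing (Polynomial k) (HomLND.kernel (HomLND.D k)) 2 ∧
    -- it contains no nonzero linear form in `x, y, z` over `R`, and `D` has rank three
    (∀ b ∈ HomLND.kernel (HomLND.D k), b.IsHomogeneous 1 → b = 0) ∧
    HomLND.rank (HomLND.D k) = 3 :=
  ⟨HomLND.isHomogeneous_F k, HomLND.isHomogeneous_G k, HomLND.isHomogeneous_P k,
    HomLND.isLocallyNilpotent_D k, HomLND.isHomogeneousOfDegree_D k, HomLND.iterate_D_x k,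
    HomLND.iterate_D_y k, HomLND.iterate_D_z k, HomLND.G_sq_sub k,
    HomLND.kernel_restrictScalars_eq_adjoin k, HomLND.exists_kernel_algEquiv k,
    HomLND.not_isPolynomialRing_kernel k,
    fun _ hD hb => HomLND.eq_zero_of_mem_kernel_of_isHomogeneous_one k hD hb, HomLND.rank_D k⟩
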